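/- **Proposition 5.4.** Let $\mathcal A$ be a unital complex $*$-algebra with a faithful tracial state $\tau$, and let $a\in\mathcal A$ be self-adjoint with mean $\tau(a)=\lambda\in\mathbb R$ and variance $\tau((a-\lambda 1)^2)=\sigma^2\neq 0$. Let $(a_k)_{k\in\mathbb N}\subset\mathcal A$ be free copies of $a$, i.e. self-adjoint elements with $\tau(a_k^m)=\tau(a^m)$ for all $k,m$, such that the unital algebras generated by the individual $a_k$ are free with respect to $\tau$. Put $\delta>0$, $\delta^2=\operatorname{var}(a\otimes a)=\tau\otimes\tau\big((a\otimes a-\lambda^2)^2\big)=\sigma^2(\sigma^2+2\lambda^2)$, $$q=\frac{2\lambda^2}{\sigma^2+2\lambda^2},\qquad b_k=\frac1\delta\big(a_k\otimes a_k-\tau\otimes\tau(a_k\otimes a_k)\big)\in\mathcal A\otimes\mathcal A .$$ Let $p\ge 4$ be an even integer and let $\pi$ be a partition of $[p]=\{1,\dots,p\}$ all of whose blocks have two elements. Assume that $\pi$ is connected, i.e. no nonempty proper subinterval of $[p]$ is a union of blocks of $\pi$. Let $G(\pi)$ be the intersection graph of $\pi$: its vertices are the blocks, and two distinct blocks $V,W$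 are adjacent if, up to exchanging $V$ and $W$, there are points $i<k<j<l$ with $i,j\in V$ and $k,l\in W$. Define $$\tau\otimes\tau(\pi):=\tau\otimes\tau(b_{i_1}b_{i_2}\cdots b_{i_p}),$$ where $i\in\mathbb N^p$ is any sequence such that $i_r=i_s$ if and only if $r$ and $s$ lie in the same block of $\pi$. Then, for every such sequence $i$: 1. if $G(\pi)$ is not bipartite, then $\tau\otimes\tau(\pi)=0$; 2. if $G(\pi)$ is bipartite, then $\tau\otimes\tau(\pi)=2\left(\dfrac q2\right)^{p/2}$. -/

import Mathlib

open scoped TensorProduct ComplexOrder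

noncomputable section

/-! ### Tracial noncommutative probability spaces -/

section NoncommutativeProbability

variable {A : Type*} [Ring A] [Algebra ℂ A]

/-- `τ` is a faithful tracial state on the unital complex `*`-algebra `A`. In the partial order
on `ℂ`, `0 ≤ z` says that `z` is real and nonnegative. -/
structure IsFaithfulTracialState [StarRing A] (τ : A →ₗ[ℂ] ℂ) : Prop where
  map_one : τ 1 = 1
  nonneg : ∀ x : A, 0 ≤ τ (star x * x)
  tracial : ∀ x y : A, τ (x * y) = τ (y * x)
  faithful : ∀ x : A, τ (star x * x) = 0 → x = 0

/-- Freeness of a family of unital subalgebras: a product of centered elements is centered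
whenever consecutive factors come from subalgebras with different indices. -/
def FreeSubalgebras {ι : Type*} (τ : A →ₗ[ℂ] ℂ) (S : ι → Subalgebra ℂ A) : Prop :=
  ∀ (m : ℕ), 1 ≤ m → ∀ (j : Fin m → ι) (c : Fin m → A),
    (∀ r, c r ∈ S (j r)) → (∀ r, τ (c r) = 0) →
    (∀ r s : Fin m, (r : ℕ) + 1 = (s : ℕ) → j r ≠ j s) →
    τ (List.ofFn c).prod = 0

/-- Random variables are free if the unital subalgebras that they generate are free. -/
def FreeVariables {ι : Type*} (τ : A →ₗ[ℂ] ℂ) (x : ι → A) : Prop :=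
  FreeSubalgebras τ fun k => Algebra.adjoin ℂ {x k}

/-- Two (self-adjoint) elements have the same law if they have the same moments. -/
def SameLaw (τ : A →ₗ[ℂ] ℂ) (x y : A) : Prop :=
  ∀ m : ℕ, τ (x ^ m) = τ (y ^ m)

/-- The element `x - φ(x) 1`. -/
def centered (φ : A →ₗ[ℂ] ℂ) (x : A) : A :=
  x - algebraMap ℂ A (φ x)

/-- The variance `φ((x - φ(x) 1)²)`. -/
def ncVariance (φ : A →ₗ[ℂ] ℂ) (x : A) : ℂ :=
  φ (centered φ x ^ 2)

/-- The functional `τ ⊗ τ` on `A ⊗ A`, determined by `x ⊗ y ↦ τ(x) τ(y)`. -/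
def tensorState (τ : A →ₗ[ℂ] ℂ) : A ⊗[ℂ] A →ₗ[ℂ] ℂ :=
  LinearMap.mul' ℂ ℂ ∘ₗ TensorProduct.map τ τ

/-- The standard deviation `δ` of `a ⊗ a`. Its variance is real and nonnegative when `a` is
self-adjoint and `τ` is a state. -/
def tensorStdDev (τ : A →ₗ[ℂ] ℂ) (a : A) : ℝ :=
  Real.sqrt (ncVariance (tensorState τ) (a ⊗ₜ[ℂ] a)).re

/-- The normalized tensor `(y ⊗ y - (τ ⊗ τ)(y ⊗ y)) / δ` with `δ` the standard deviation of
`a ⊗ a`. -/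
def normalizedTensor (τ : A →ₗ[ℂ] ℂ) (a y : A) : A ⊗[ℂ] A :=
  ((tensorStdDev τ a : ℂ))⁻¹ • centered (tensorState τ) (y ⊗ₜ[ℂ] y)

end NoncommutativeProbability

/-! ### Partitions of `{0, …, p - 1}` -/

/-- Partitions of a set with `p` linearly ordered points. -/
abbrev PointPartition (p : ℕ) : Type := Finpartition (Finset.univ : Finset (Fin p))

namespace PointPartition

variable {p : ℕ}

/-- All blocks have two elements. -/
def IsPair (π : PointPartition p) : Prop :=
  ∀ V ∈ π.parts, V.card = 2

/-- No proper (nonempty) subinterval is a union of blocks. -/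
def IsConnected (π : PointPartition p) : Prop :=
  ∀ c d : Fin p, c ≤ d → Finset.Icc c d ≠ Finset.univ →
    ¬ ∃ S : Finset (Finset (Fin p)), S ⊆ π.parts ∧ S.biUnion id = Finset.Icc c d

/-- There are points `i < k < j < l` with `i, j ∈ V` and `k, l ∈ W`. -/
def Crosses (V W : Finset (Fin p)) : Prop :=
  ∃ i ∈ V, ∃ k ∈ W, ∃ j ∈ V, ∃ l ∈ W, i < k ∧ k < j ∧ j < l

/-- The intersection graph: its vertices are the blocks, and two different blocks are adjacent
if one of them crosses the other. -/
def intersectionGraph (π : PointPartition p) : SimpleGraph {V : Finset (Fin p) // V ∈ π.parts} :=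
  SimpleGraph.fromRel fun V W => Crosses V.1 W.1

/-- The partition `π` is the one defined by the index sequence `i`: two points lie in the same
block if and only if they carry the same index. -/
def IsKernelOf (π : PointPartition p) (i : Fin p → ℕ) : Prop :=
  ∀ r s : Fin p, (∃ V ∈ π.parts, r ∈ V ∧ s ∈ V) ↔ i r = i s

end PointPartition

end

/-! ### Words with non-crossing pairings -/

/-! Write each free copy as `lam + c k` with `c k` centered. The constant `lam ^ 2` cancels, so a
normalized tensor is `δ⁻¹` times `c ⊗ c + lam (c ⊗ 1) + lam (1 ⊗ c)`. Expanding the product gives a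
sum over maps `f` saying which tensor legs carry `c` at each point
(`tensorState_prod_normalizedTensor`). Each term contains two moments of free centered variables,
along words in which no letter occurs more than twice. Such a moment vanishes unless the word is a
non-crossing pairing, where it is `σ` to the length (`FreeSubalgebras.map_prod_of_ncWord`,
`FreeSubalgebras.map_prod_of_not_ncWord`).

In a surviving term no leg carries two crossing blocks, yet every point is carried by some leg.
Crossing blocks therefore sit in exactly one leg each, and in opposite ones. Since `π` is connected,
so is its intersection graph (`IsConnected.preconnected`); as `2 < p`, every block has a neighbor,
and `f` is a proper 2-coloring (`NCSelection.exists_coloring`). A connected graph has no such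
coloring or exactly two, exchanged by swapping colors (`colorSelection_eq_or`). Each contributes
`(lam * σ / δ) ^ p = (q / 2) ^ (p / 2)`. -/

/-- Words obtained from the empty word by successively inserting two adjacent copies of a letter
that does not yet occur. -/
inductive NCWord {ι : Type*} : List ι → Prop
  | nil : NCWord []
  | insert (u : List ι) (k : ι) (v : List ι) (hu : k ∉ u) (hv : k ∉ v) (h : NCWord (u ++ v)) :
      NCWord (u ++ k :: k :: v)

theorem List.exists_split_of_not_isChain {α : Type*} {R : α → α → Prop} {l : List α}
    (h : ¬ l.IsChain R) : ∃ u a b v, l = u ++ a :: b :: v ∧ ¬ R a b := by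
  induction l with
  | nil => simp at h
  | cons a l ih =>
    cases l with
    | nil => simp at h
    | cons b l =>
      by_cases hab : R a b
      · have h' : ¬ (b :: l).IsChain R := fun hc => h (List.isChain_cons_cons.2 ⟨hab, hc⟩)
        obtain ⟨u, x, y, v, e, hR⟩ := ih h'
        exact ⟨a :: u, x, y, v, by simp [e], hR⟩
      · exact ⟨[], a, b, l, rfl, hab⟩

theorem NCWord.filter {ι : Type*} {l : List ι} (h : NCWord l) (P : ι → Bool) : NCWord (l.filter P) := by
  induction h with
  | nil => exact .nil
  | insert u k v hu hv h ih =>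
    rw [List.filter_append] at ih ⊢
    by_cases hk : P k
    · simp only [List.filter_cons, hk, if_true]
      exact .insert _ _ _ (fun hm => hu (List.mem_of_mem_filter hm))
        (fun hm => hv (List.mem_of_mem_filter hm)) ih
    · simpa [List.filter_cons, hk] using ih

/-! ### Moments of free centered variables -/

section Free

variable {A : Type*} [Ring A] [Algebra ℂ A] {ι : Type*}

/-- The letters of `l` are centered elements of the subalgebras that label them. -/
def CenteredLetters (τ : A →ₗ[ℂ] ℂ) (S : ι → Subalgebra ℂ A) (l : List (ι × A)) : Prop :=
  ∀ x ∈ l, x.2 ∈ S x.1 ∧ τ x.2 = 0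

theorem FreeSubalgebras.map_prod_eq_zero {τ : A →ₗ[ℂ] ℂ} {S : ι → Subalgebra ℂ A}
    (h : FreeSubalgebras τ S) {l : List (ι × A)} (hl : l ≠ []) (hc : CenteredLetters τ S l)
    (hchain : l.IsChain fun x y => x.1 ≠ y.1) : τ (l.map Prod.snd).prod = 0 := by
  have := h l.length (List.length_pos_iff.2 hl) (fun r => (l.get r).1) (fun r => (l.get r).2)
    (fun r => (hc _ (List.get_mem l r)).1) (fun r => (hc _ (List.get_mem l r)).2) ?_
  · have e : List.ofFn (fun r => (l.get r).2) = l.map Prod.snd := by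
      conv_rhs => rw [← List.ofFn_get l, List.map_ofFn]
      rfl
    rwa [e] at this
  · intro r s hrs
    have := List.isChain_iff_getElem.1 hchain r.1 (by omega)
    simpa [List.get_eq_getElem, hrs] using this

variable [DecidableEq ι]

/-- Two adjacent factors from the same subalgebra merge into a scalar plus a centered element `d`.
The scalar term keeps the isolated letter; in the other term the label of `d` now occurs once. Both
are shorter, and freeness settles words without adjacent repetitions. Letters are arbitrary elements
so that `d` is allowed. -/
theorem FreeSubalgebras.map_prod_eq_zero_of_count_eq_one {τ : A →ₗ[ℂ] ℂ} (h1 : τ 1 = 1)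
    {S : ι → Subalgebra ℂ A} (h : FreeSubalgebras τ S) (l : List (ι × A))
    (hc : CenteredLetters τ S l) (h2 : ∀ k, (l.map Prod.fst).count k ≤ 2)
    (hs : ∃ k, (l.map Prod.fst).count k = 1) : τ (l.map Prod.snd).prod = 0 := by
  induction hn : l.length using Nat.strong_induction_on generalizing l with
  | _ n ih =>
    obtain ⟨k₀, hk₀⟩ := hs
    by_cases hchain : l.IsChain fun x y => x.1 ≠ y.1
    · refine h.map_prod_eq_zero ?_ hc hchain
      rintro rfl
      simp at hk₀
    · obtain ⟨u, ⟨k, e⟩, ⟨k', e'⟩, v, rfl, hkk⟩ := List.exists_split_of_not_isChain hchain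
      obtain rfl : k = k' := by simpa using hkk
      have he := hc (k, e) (by simp)
      have he' := hc (k, e') (by simp)
      set d : A := e * e' - algebraMap ℂ A (τ (e * e')) with hd
      have hdS : d ∈ S k := sub_mem (mul_mem he.1 he'.1) (Subalgebra.algebraMap_mem _ _)
      have hdτ : τ d = 0 := by
        rw [hd, map_sub, Algebra.algebraMap_eq_smul_one, map_smul, h1]; simp
      have hk2 := h2 k
      simp only [List.map_append, List.map_cons, List.count_append, List.count_cons_self] at hk2
      have key : ((u ++ (k, e) :: (k, e') :: v).map Prod.snd).prod
          = τ (e * e') • ((u ++ v).map Prod.snd).prod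
            + ((u ++ (k, d) :: v).map Prod.snd).prod := by
        simp only [List.map_append, List.map_cons, List.prod_append, List.prod_cons, hd,
          Algebra.algebraMap_eq_smul_one, sub_mul, mul_sub, smul_mul_assoc, mul_smul_comm,
          one_mul, mul_assoc]
        abel
      have hne : k₀ ≠ k := by
        rintro rfl
        simp at hk₀
        omega
      have huv : τ ((u ++ v).map Prod.snd).prod = 0 := by
        refine ih (u ++ v).length (by simp [← hn]) (u ++ v) ?_ ?_ ⟨k₀, ?_⟩ rfl
        · intro x hx
          refine hc x ?_
          simp only [List.mem_append, List.mem_cons] at hx ⊢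
          tauto
        · intro j
          have := h2 j
          simp only [List.map_append, List.map_cons, List.count_append, List.count_cons] at this ⊢
          omega
        · simpa [List.count_cons, hne.symm] using hk₀
      have hudv : τ ((u ++ (k, d) :: v).map Prod.snd).prod = 0 := by
        refine ih (u ++ (k, d) :: v).length (by simp [← hn]) (u ++ (k, d) :: v) ?_ ?_ ⟨k, ?_⟩ rfl
        · intro x hx
          simp only [List.mem_append, List.mem_cons] at hx
          rcases hx with hx | rfl | hx
          · exact hc x (by simp [hx])
          · exact ⟨hdS, hdτ⟩
          · exact hc x (by simp [hx])
        · intro j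
          have := h2 j
          simp only [List.map_append, List.map_cons, List.count_append, List.count_cons] at this ⊢
          omega
        · simp only [List.map_append, List.map_cons, List.count_append, List.count_cons_self]
          omega
      rw [key, map_add, map_smul, huv, hudv]
      simp

variable {τ : A →ₗ[ℂ] ℂ} {S : ι → Subalgebra ℂ A} {c : ι → A} {s : ℂ}

/-- The centered part of `c k ^ 2` is a letter whose label occurs once, so only the scalar `s ^ 2`
survives. -/
theorem FreeSubalgebras.map_prod_insert (h1 : τ 1 = 1) (h : FreeSubalgebras τ S)
    (hS : ∀ k, c k ∈ S k) (h0 : ∀ k, τ (c k) = 0) (hs : ∀ k, τ (c k ^ 2) = s ^ 2)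
    {u v : List ι} {k : ι} (h2 : ∀ j, (u ++ k :: k :: v).count j ≤ 2) :
    τ ((u ++ k :: k :: v).map c).prod = s ^ 2 * τ ((u ++ v).map c).prod := by
  set d : A := c k ^ 2 - algebraMap ℂ A (s ^ 2) with hd
  have hdS : d ∈ S k := sub_mem (pow_mem (hS k) 2) (Subalgebra.algebraMap_mem _ _)
  have hdτ : τ d = 0 := by
    rw [hd, map_sub, Algebra.algebraMap_eq_smul_one, map_smul, h1, hs]; simp
  have key : ((u ++ k :: k :: v).map c).prod
      = s ^ 2 • ((u ++ v).map c).prod + (u.map c).prod * (d * (v.map c).prod) := by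
    simp only [List.map_append, List.map_cons, List.prod_append, List.prod_cons, hd,
      Algebra.algebraMap_eq_smul_one, sub_mul, mul_sub, smul_mul_assoc, mul_smul_comm,
      one_mul, mul_assoc, sq (c k)]
    abel
  have hk := h2 k
  simp only [List.count_append, List.count_cons_self] at hk
  have hz := h.map_prod_eq_zero_of_count_eq_one h1
    (u.map (fun j => (j, c j)) ++ (k, d) :: v.map (fun j => (j, c j))) ?_ ?_ ⟨k, ?_⟩
  · simp only [List.map_append, List.map_cons, List.map_map, List.prod_append,
      List.prod_cons] at hz
    rw [key, map_add, map_smul, smul_eq_mul]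
    simpa [Function.comp_def] using hz
  · intro x hx
    simp only [List.mem_append, List.mem_cons, List.mem_map] at hx
    rcases hx with ⟨j, -, rfl⟩ | rfl | ⟨j, -, rfl⟩
    · exact ⟨hS j, h0 j⟩
    · exact ⟨hdS, hdτ⟩
    · exact ⟨hS j, h0 j⟩
  · intro j
    have := h2 j
    simp only [List.map_append, List.map_cons, List.map_map, List.count_append, List.count_cons,
      Function.comp_def, List.map_id'] at this ⊢
    omega
  · simp only [List.map_append, List.map_cons, List.map_map, List.count_append,
      List.count_cons_self, Function.comp_def, List.map_id']
    omega

theorem NCWord.count_eq {l : List ι} (h : NCWord l) (k : ι) : l.count k = 0 ∨ l.count k = 2 := by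
  induction h with
  | nil => simp
  | insert u j v hu hv h ih =>
    by_cases hjk : j = k
    · subst hjk
      right
      simp [List.count_eq_zero_of_not_mem hu, List.count_eq_zero_of_not_mem hv]
    · simpa [List.count_cons, hjk] using ih

/-- Mixed moments of centered free variables with common variance along non-crossing words. -/
theorem FreeSubalgebras.map_prod_of_ncWord (h1 : τ 1 = 1) (h : FreeSubalgebras τ S)
    (hS : ∀ k, c k ∈ S k) (h0 : ∀ k, τ (c k) = 0) (hs : ∀ k, τ (c k ^ 2) = s ^ 2)
    {l : List ι} (hl : NCWord l) : τ (l.map c).prod = s ^ l.length := by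
  induction hl with
  | nil => simpa using h1
  | insert u k v hu hv hl ih =>
    rw [h.map_prod_insert h1 hS h0 hs, ih]
    · simp only [List.length_append, List.length_cons]; ring
    · intro j
      rcases (NCWord.insert u k v hu hv hl).count_eq j with e | e <;> omega

/-- Deleting an adjacent pair costs a factor `s ^ 2` and cannot produce a non-crossing word; once no
such pair is left, freeness gives zero. -/
theorem FreeSubalgebras.map_prod_of_not_ncWord (h1 : τ 1 = 1) (h : FreeSubalgebras τ S)
    (hS : ∀ k, c k ∈ S k) (h0 : ∀ k, τ (c k) = 0) (hs : ∀ k, τ (c k ^ 2) = s ^ 2)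
    (l : List ι) (h2 : ∀ k, l.count k ≤ 2) (hl : ¬ NCWord l) : τ (l.map c).prod = 0 := by
  induction hn : l.length using Nat.strong_induction_on generalizing l with
  | _ n ih =>
    by_cases hchain : l.IsChain (· ≠ ·)
    · have := h.map_prod_eq_zero (l := l.map fun j => (j, c j)) ?_ ?_ ?_
      · simpa [Function.comp_def] using this
      · intro e
        rw [List.map_eq_nil_iff] at e
        exact hl (e ▸ NCWord.nil)
      · intro x hx
        obtain ⟨j, -, rfl⟩ := List.mem_map.1 hx
        exact ⟨hS j, h0 j⟩
      · rwa [List.isChain_map]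
    · obtain ⟨u, k, k', v, rfl, hkk⟩ := List.exists_split_of_not_isChain hchain
      obtain rfl : k = k' := by simpa using hkk
      have hk := h2 k
      simp only [List.count_append, List.count_cons_self] at hk
      rw [h.map_prod_insert h1 hS h0 hs h2, ih (u ++ v).length (by simp [← hn]) _ ?_ ?_ rfl,
        mul_zero]
      · intro j
        have := h2 j
        simp only [List.count_append, List.count_cons] at this ⊢
        omega
      · exact fun hh => hl (.insert u k v (List.count_eq_zero.1 (by omega))
          (List.count_eq_zero.1 (by omega)) hh)

end Free

/-! ### Non-crossing words as words avoiding the pattern `k m k m` -/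

section Words

variable {ι : Type*} [DecidableEq ι]

/-- Restricting to the letters `k` and `m` preserves `NCWord`, and the counts leave exactly `k m k
m`, which has no adjacent equal letters to start from. -/
theorem NCWord.not_sublist {l : List ι} (h : NCWord l) {k m : ι} (hkm : k ≠ m) :
    ¬ [k, m, k, m].Sublist l := by
  intro hsub
  let P : ι → Bool := fun x => decide (x = k ∨ x = m)
  have hlen : ∀ l : List ι, (l.filter P).length = l.count k + l.count m := by
    intro l
    induction l with
    | nil => simp
    | cons a l ih =>
      by_cases h1 : a = k
      · subst h1; simp [P, hkm] at ih ⊢; omega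
      · by_cases h2 : a = m
        · subst h2; simp [P, hkm.symm] at ih ⊢; omega
        · simpa [P, h1, h2, List.count_cons] using ih
  have hP : [k, m, k, m].filter P = [k, m, k, m] := by simp [P]
  have hsub' := hsub.filter P
  rw [hP] at hsub'
  have heq : [k, m, k, m] = l.filter P := by
    refine hsub'.eq_of_length_le ?_
    rw [hlen]
    rcases h.count_eq k with e | e <;> rcases h.count_eq m with e' | e' <;> simp [e, e']
  have hnc := h.filter P
  rw [← heq] at hnc
  have hchain : [k, m, k, m].IsChain (· ≠ ·) := by simp [hkm, hkm.symm]
  generalize hw : [k, m, k, m] = w at hnc hchain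
  cases hnc with
  | nil => simp at hw
  | insert u j v hu hv h =>
    have := List.isChain_append.1 hchain
    simp at this

theorem NCWord.append_middle {u : List ι} (hu : NCWord u) {a b : List ι} (h : NCWord (a ++ b))
    (ha : ∀ k ∈ u, k ∉ a) (hb : ∀ k ∈ u, k ∉ b) : NCWord (a ++ u ++ b) := by
  induction hu with
  | nil => simpa using h
  | insert w k v hw hv _ ih =>
    have := ih (fun j hj => ha j (by simp at hj ⊢; tauto)) (fun j hj => hb j (by simp at hj ⊢; tauto))
    have h2 := NCWord.insert (a ++ w) k (v ++ b) (by simp [hw, ha k]) (by simp [hv, hb k])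
      (by simpa using this)
    simpa using h2

/-- Split the word as `k u k v`. A letter common to `u` and `v` would cross `k`, so `u` and `v` are
separately paired and induction applies to each. -/
theorem NCWord.of_not_sublist (l : List ι) (hc : ∀ k, l.count k = 0 ∨ l.count k = 2)
    (hl : ∀ k m, k ≠ m → ¬ [k, m, k, m].Sublist l) : NCWord l := by
  induction hn : l.length using Nat.strong_induction_on generalizing l with
  | _ n ih =>
    cases l with
    | nil => exact .nil
    | cons k t =>
      have hk : t.count k = 1 := by
        have := hc k
        rw [List.count_cons_self] at this
        omega
      obtain ⟨u, v, rfl⟩ := List.append_of_mem (List.count_pos_iff.1 (by omega : 0 < t.count k))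
      simp only [List.count_append, List.count_cons_self] at hk
      have hku : k ∉ u := List.count_eq_zero.1 (by omega)
      have hkv : k ∉ v := List.count_eq_zero.1 (by omega)
      have hdisj : ∀ m ∈ u, m ∉ v := by
        intro m hmu hmv
        refine hl k m (by rintro rfl; exact hku hmu) (List.Sublist.cons_cons k ?_)
        exact (List.singleton_sublist.2 hmu).append
          (List.Sublist.cons_cons k (List.singleton_sublist.2 hmv))
      have hu : NCWord u := by
        refine ih u.length (by simp at hn; omega) u (fun j => ?_) (fun j m hjm hs => hl j m hjm ?_) rfl
        · by_cases hj : j ∈ u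
          · have := hc j
            rwa [List.count_cons_of_ne (by rintro rfl; exact hku hj), List.count_append,
              List.count_cons_of_ne (by rintro rfl; exact hku hj),
              List.count_eq_zero_of_not_mem (hdisj j hj), add_zero] at this
          · exact Or.inl (List.count_eq_zero_of_not_mem hj)
        · exact (hs.trans (List.sublist_append_left u (k :: v))).trans (List.sublist_cons_self _ _)
      have hv : NCWord v := by
        refine ih v.length (by simp at hn; omega) v (fun j => ?_) (fun j m hjm hs => hl j m hjm ?_) rfl
        · by_cases hj : j ∈ v
          · have := hc j
            rwa [List.count_cons_of_ne (by rintro rfl; exact hkv hj), List.count_append,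
              List.count_cons_of_ne (by rintro rfl; exact hkv hj),
              List.count_eq_zero_of_not_mem (fun h => hdisj j h hj), zero_add] at this
          · exact Or.inl (List.count_eq_zero_of_not_mem hj)
        · exact ((hs.trans (List.sublist_cons_self _ _)).trans
            (List.sublist_append_right u (k :: v))).trans (List.sublist_cons_self _ _)
      have := hu.append_middle (a := [k]) (b := k :: v)
        (NCWord.insert [] k v (by simp) hkv (by simpa using hv))
        (fun j hj => by simp; rintro rfl; exact hku hj)
        (fun j hj => by simp; exact ⟨by rintro rfl; exact hku hj, hdisj j hj⟩)
      simpa using this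

end Words

/-! ### Connectedness of the intersection graph -/

namespace PointPartition

variable {p : ℕ} {π : PointPartition p}

/-- The block of a point, as a vertex of the intersection graph. -/
def block (π : PointPartition p) (r : Fin p) : {V : Finset (Fin p) // V ∈ π.parts} :=
  ⟨π.part r, π.part_mem.2 (Finset.mem_univ r)⟩

theorem mem_block (r : Fin p) : r ∈ (π.block r).1 :=
  π.mem_part_self.2 (Finset.mem_univ r)

theorem block_eq_of_mem {V : {V : Finset (Fin p) // V ∈ π.parts}} {r : Fin p} (h : r ∈ V.1) :
    π.block r = V :=
  Subtype.ext (π.part_eq_of_mem V.2 h)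

theorem exists_block_eq (V : {V : Finset (Fin p) // V ∈ π.parts}) : ∃ r, π.block r = V := by
  obtain ⟨r, hr⟩ := π.nonempty_of_mem_parts V.2
  exact ⟨r, block_eq_of_mem hr⟩

theorem intersectionGraph_adj {V W : {V : Finset (Fin p) // V ∈ π.parts}} :
    π.intersectionGraph.Adj V W ↔ V ≠ W ∧ (Crosses V.1 W.1 ∨ Crosses W.1 V.1) :=
  SimpleGraph.fromRel_adj _ _ _

/-- Blocks that are joined by a path of blocks other than `W` lie on the same side of two points
of `W`. -/
theorem between_iff_of_reachable {V B W : {V : Finset (Fin p) // V ∈ π.parts}}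
    (hW : ¬ π.intersectionGraph.Reachable V W) (hB : π.intersectionGraph.Reachable V B)
    {r s : Fin p} (hr : r ∈ W.1) (hs : s ∈ W.1) {t t' : Fin p} (ht : t ∈ B.1) (ht' : t' ∈ V.1) :
    (r < t ∧ t < s) ↔ (r < t' ∧ t' < s) := by
  -- A block with points both inside and outside the interval from `r` to `s` would cross `W`, hence
  -- be adjacent to it.
  have hsep : ∀ B, π.intersectionGraph.Reachable V B → ∀ t ∈ B.1, ∀ t' ∈ B.1,
      (r < t ∧ t < s) → (r < t' ∧ t' < s) := by
    intro B hB t ht t' ht' h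
    by_contra hn
    have hne : B ≠ W := fun e => hW (e ▸ hB)
    have hnadj : ¬ π.intersectionGraph.Adj B W := fun h => hW (hB.trans h.reachable)
    rw [intersectionGraph_adj] at hnadj
    have hr' : t' ≠ r := by
      rintro rfl
      exact hne ((block_eq_of_mem ht').symm.trans (block_eq_of_mem hr))
    have hs' : t' ≠ s := by
      rintro rfl
      exact hne ((block_eq_of_mem ht').symm.trans (block_eq_of_mem hs))
    refine hnadj ⟨hne, ?_⟩
    rcases lt_or_gt_of_ne hr' with h1 | h1
    · exact Or.inl ⟨t', ht', r, hr, t, ht, s, hs, h1, h.1, h.2⟩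
    · have h2 : s < t' := lt_of_le_of_ne (not_lt.1 fun h2 => hn ⟨h1, h2⟩) hs'.symm
      exact Or.inr ⟨r, hr, t, ht, s, hs, t', ht', h.1, h.2, h2⟩
  have hcross : ∀ B C, π.intersectionGraph.Reachable V B → π.intersectionGraph.Reachable V C →
      Crosses B.1 C.1 → ∀ t ∈ B.1, ∀ t' ∈ C.1, ((r < t ∧ t < s) ↔ (r < t' ∧ t' < s)) := by
    rintro B C hB hC ⟨i, hi, k, hk, j, hj, l, hl, hik, hkj, hjl⟩ t ht t' ht'
    constructor
    · intro h
      exact hsep C hC k hk t' ht' ⟨(hsep B hB t ht i hi h).1.trans hik,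
        hkj.trans (hsep B hB t ht j hj h).2⟩
    · intro h
      exact hsep B hB j hj t ht ⟨(hsep C hC t' ht' k hk h).1.trans hkj,
        hjl.trans (hsep C hC t' ht' l hl h).2⟩
  rw [SimpleGraph.reachable_iff_reflTransGen] at hB
  induction hB generalizing t with
  | refl => exact ⟨hsep V .rfl t ht t' ht', hsep V .rfl t' ht' t ht⟩
  | tail h1 h2 ih =>
    rename_i B C
    have hVB : π.intersectionGraph.Reachable V B :=
      (SimpleGraph.reachable_iff_reflTransGen _ _).2 h1
    obtain ⟨b, hb⟩ := π.nonempty_of_mem_parts B.2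
    refine Iff.trans ?_ (ih hb)
    rcases (intersectionGraph_adj.1 h2).2 with h | h
    · exact (hcross B C hVB (hVB.trans h2.reachable) h b hb t ht).symm
    · exact hcross C B (hVB.trans h2.reachable) hVB h t ht b hb

-- Take the convex hull of the points in a component. A foreign block meeting the hull cannot leave
-- it: the whole component lies on one side of any two of its points, including both ends of the
-- hull. So the hull is a union of blocks, hence everything, and every component contains the block
-- of the first point.
open Classical in
theorem IsConnected.preconnected (hconn : π.IsConnected) : π.intersectionGraph.Preconnected := by
  suffices H : ∀ (V : {V : Finset (Fin p) // V ∈ π.parts}) (z : Fin p), (∀ r, z ≤ r) →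
      π.intersectionGraph.Reachable V (π.block z) by
    intro V W
    obtain ⟨r, -⟩ := exists_block_eq V
    let z : Fin p := ⟨0, r.pos⟩
    have hz : ∀ r, z ≤ r := fun r => Nat.zero_le _
    exact (H V z hz).trans (H W z hz).symm
  intro V z hz
  set U : Finset (Fin p) := Finset.univ.filter fun r =>
    π.intersectionGraph.Reachable V (π.block r) with hU
  have hmemU : ∀ r, r ∈ U ↔ π.intersectionGraph.Reachable V (π.block r) := by simp [hU]
  obtain ⟨t, ht⟩ := exists_block_eq V
  have hne : U.Nonempty := ⟨t, by rw [hmemU, ht]⟩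
  have hc := U.min'_mem hne
  have hd := U.max'_mem hne
  set c := U.min' hne
  set d := U.max' hne
  have hcd : c ≤ d := U.min'_le _ hd
  have hblock : ∀ r ∈ Finset.Icc c d, ∀ s ∈ (π.block r).1, s ∈ Finset.Icc c d := by
    intro r hr s hs
    rw [Finset.mem_Icc] at hr
    by_cases hrU : r ∈ U
    · have hsU : s ∈ U := by
        rw [hmemU, block_eq_of_mem hs, ← hmemU]
        exact hrU
      exact Finset.mem_Icc.2 ⟨U.min'_le _ hsU, U.le_max' _ hsU⟩
    · have hcr : c < r := lt_of_le_of_ne hr.1 (by rintro e; exact hrU (e ▸ hc))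
      have hrd : r < d := lt_of_le_of_ne hr.2 (by rintro e; exact hrU (e ▸ hd))
      have hW := hrU
      rw [hmemU] at hW hc hd
      have hmem : r ∈ (π.block r).1 := mem_block r
      obtain ⟨v, hv⟩ := π.nonempty_of_mem_parts V.2
      have h1 := between_iff_of_reachable hW hc hs hmem (mem_block c) hv
      have h2 := between_iff_of_reachable hW hd hs hmem (mem_block d) hv
      have h3 := between_iff_of_reachable hW hc hmem hs (mem_block c) hv
      have h4 := between_iff_of_reachable hW hd hmem hs (mem_block d) hv
      rw [Finset.mem_Icc]
      constructor
      · by_contra! hsc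
        exact absurd (h2.2 (h1.1 ⟨hsc, hcr⟩)).2 (not_lt.2 hrd.le)
      · by_contra! hsd
        exact absurd (h3.2 (h4.1 ⟨hrd, hsd⟩)).1 (not_lt.2 hcr.le)
  have huniv : Finset.Icc c d = Finset.univ := by
    by_contra hn
    refine hconn c d hcd hn ⟨π.parts.filter (· ⊆ Finset.Icc c d), Finset.filter_subset _ _, ?_⟩
    ext r
    simp only [Finset.mem_biUnion, Finset.mem_filter, id]
    constructor
    · rintro ⟨B, ⟨-, hB⟩, hr⟩
      exact hB hr
    · intro hr
      exact ⟨(π.block r).1, ⟨(π.block r).2, hblock r hr⟩, mem_block r⟩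
  have hzc : c ≤ z := (Finset.mem_Icc.1 (huniv ▸ Finset.mem_univ z)).1
  rw [← hmemU, le_antisymm (hz c) hzc]
  exact hc

theorem IsPair.exists_adj (hpair : π.IsPair) (hconn : π.IsConnected) (hp : 2 < p)
    (V : {V : Finset (Fin p) // V ∈ π.parts}) : ∃ W, π.intersectionGraph.Adj V W := by
  have : ∃ r : Fin p, r ∉ V.1 := by
    by_contra! h
    have h2 := hpair V.1 V.2
    rw [Finset.eq_univ_iff_forall.2 h, Finset.card_univ, Fintype.card_fin] at h2
    omega
  obtain ⟨r, hr⟩ := this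
  have hne : V ≠ π.block r := by
    rintro rfl
    exact hr (mem_block r)
  have := hconn.preconnected V (π.block r)
  rw [SimpleGraph.reachable_iff_reflTransGen] at this
  rcases this.cases_head with h | ⟨W, hW, -⟩
  · exact absurd h hne
  · exact ⟨W, hW⟩

/-! ### Words carried by one tensor leg -/

/-- The letters `i r` with `g r` true, in increasing order of `r`. -/
def subword (i : Fin p → ℕ) (g : Fin p → Bool) : List ℕ :=
  ((List.finRange p).filter g).map i

variable {i : Fin p → ℕ} {g : Fin p → Bool}

theorem count_subword (k : ℕ) :
    (subword i g).count k = (Finset.univ.filter fun r => i r = k ∧ g r = true).card := by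
  rw [subword, List.count, List.countP_map, List.countP_filter, Finset.card, Finset.filter,
    Fin.univ_def]
  simp [List.countP_eq_length_filter, beq_eq_decide]

theorem IsKernelOf.mem_block_iff (hi : π.IsKernelOf i) {r s : Fin p} :
    s ∈ (π.block r).1 ↔ i s = i r := by
  rw [← hi s r]
  constructor
  · intro h
    exact ⟨_, (π.block r).2, h, mem_block r⟩
  · rintro ⟨V, hV, hs, hr⟩
    rwa [block_eq_of_mem (V := ⟨V, hV⟩) hr]

theorem IsKernelOf.block_eq_iff (hi : π.IsKernelOf i) {r s : Fin p} :
    π.block s = π.block r ↔ i s = i r := by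
  rw [← hi.mem_block_iff]
  exact ⟨fun h => h ▸ mem_block s, block_eq_of_mem⟩

theorem IsKernelOf.count_subword (hi : π.IsKernelOf i) (r : Fin p) :
    (subword i g).count (i r) = ((π.block r).1.filter fun s => g s = true).card := by
  rw [PointPartition.count_subword]
  congr 1
  ext s
  simp [hi.mem_block_iff]

theorem count_subword_eq_zero {k : ℕ} (hk : ∀ r, i r ≠ k) : (subword i g).count k = 0 := by
  rw [count_subword]
  simp [hk]

theorem IsPair.count_subword_le (hpair : π.IsPair) (hi : π.IsKernelOf i) (k : ℕ) :
    (subword i g).count k ≤ 2 := by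
  by_cases hk : ∃ r, i r = k
  · obtain ⟨r, rfl⟩ := hk
    rw [hi.count_subword, ← hpair _ (π.block r).2]
    exact Finset.card_filter_le _ _
  · push Not at hk
    rw [count_subword_eq_zero hk]
    omega

/-- Every letter of a non-crossing word occurs 0 or 2 times, so a block of size two is selected
entirely or not at all. -/
theorem IsPair.eq_of_ncWord (hpair : π.IsPair) (hi : π.IsKernelOf i) (h : NCWord (subword i g))
    {r s : Fin p} (hrs : i r = i s) : g r = g s := by
  have key : ∀ r s, i r = i s → g r = true → g s = true := by
    intro r s hrs hr
    have hpos : 0 < ((π.block r).1.filter fun s => g s = true).card :=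
      Finset.card_pos.2 ⟨r, Finset.mem_filter.2 ⟨mem_block r, hr⟩⟩
    have hcount := h.count_eq (i r)
    rw [hi.count_subword] at hcount
    have hcard : (π.block r).1.card ≤ ((π.block r).1.filter fun s => g s = true).card := by
      rw [hpair _ (π.block r).2]
      omega
    have heq := Finset.eq_of_subset_of_card_le (Finset.filter_subset _ _) hcard
    have hs : s ∈ (π.block r).1 := hi.mem_block_iff.2 hrs.symm
    rw [← heq] at hs
    exact (Finset.mem_filter.1 hs).2
  exact Bool.eq_iff_iff.2 ⟨key r s hrs, key s r hrs.symm⟩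

theorem not_ncWord_of_crossing {r s t u : Fin p} (hrs : r < s) (hst : s < t) (htu : t < u)
    (h1 : i r = i t) (h2 : i s = i u) (h3 : i r ≠ i s) (hr : g r = true) (hs : g s = true)
    (ht : g t = true) (hu : g u = true) : ¬ NCWord (subword i g) := by
  intro h
  refine h.not_sublist h3 ?_
  have hsub : [r, s, t, u].Sublist (List.finRange p) := by
    refine List.sublist_of_subperm_of_sortedLE ?_ ?_ ?_
    · exact List.subperm_of_subset
        (by simp [hrs.ne, hst.ne, htu.ne, (hrs.trans hst).ne, (hst.trans htu).ne,
          ((hrs.trans hst).trans htu).ne]) (fun x _ => List.mem_finRange x)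
    · rw [List.sortedLE_iff_pairwise]
      simp [hrs.le, hst.le, htu.le, (hrs.trans hst).le, (hst.trans htu).le,
          ((hrs.trans hst).trans htu).le]
    · exact (List.sortedLT_finRange p).sortedLE
  have := (hsub.filter g).map i
  simpa [hr, hs, ht, hu, ← h1, ← h2, subword] using this

theorem IsPair.ncWord_subword (hpair : π.IsPair) (hi : π.IsKernelOf i)
    (hg : ∀ r s, i r = i s → g r = g s)
    (hx : ∀ r s t u, r < s → s < t → t < u → i r = i t → i s = i u → i r ≠ i s →
      g r = true → g s = true → False) : NCWord (subword i g) := by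
  refine NCWord.of_not_sublist _ (fun k => ?_) (fun k m hkm hsub => ?_)
  · by_cases hk : ∃ r, i r = k
    · obtain ⟨r, rfl⟩ := hk
      rw [hi.count_subword]
      cases hr : g r
      · left
        rw [Finset.card_eq_zero, Finset.filter_eq_empty_iff]
        intro s hs
        rw [hg s r (hi.mem_block_iff.1 hs), hr]
        simp
      · right
        rw [← hpair _ (π.block r).2, Finset.filter_true_of_mem]
        intro s hs
        rw [hg s r (hi.mem_block_iff.1 hs), hr]
    · push Not at hk
      exact Or.inl (count_subword_eq_zero hk)
  · obtain ⟨l, hl, he⟩ := List.sublist_map_iff.1 hsub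
    have hmem : ∀ r ∈ l, g r = true := fun r hr => (List.mem_filter.1 (hl.subset hr)).2
    have hlt : l.Pairwise (· < ·) :=
      ((List.sortedLT_finRange p).pairwise.filter _).sublist hl
    rcases l with _ | ⟨r, _ | ⟨s, _ | ⟨t, _ | ⟨u, _ | ⟨y, l⟩⟩⟩⟩⟩ <;> simp at he
    obtain ⟨e1, e2, e3, e4⟩ := he
    simp at hlt hmem
    exact hx r s t u hlt.1.1 hlt.2.1.1 hlt.2.2 (e1.symm.trans e3) (e2.symm.trans e4)
      (by rwa [← e1, ← e2]) hmem.1 hmem.2.1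

/-! ### Surviving selections and 2-colorings -/

/-- Every point is selected by at least one component of `f`, and each component selects a
non-crossing word. -/
structure NCSelection (i : Fin p → ℕ) (f : Fin p → Bool × Bool) : Prop where
  ne : ∀ r, f r ≠ (false, false)
  fst : NCWord (subword i fun r => (f r).1)
  snd : NCWord (subword i fun r => (f r).2)

/-- The selection that puts the points of the blocks of one color in the first component and the
others in the second component. -/
def colorSelection (κ : π.intersectionGraph.Coloring Bool) (r : Fin p) : Bool × Bool :=
  (κ (π.block r), !κ (π.block r))

theorem adj_block (hi : π.IsKernelOf i) {r s t u : Fin p} (hrs : r < s) (hst : s < t) (htu : t < u)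
    (h1 : i r = i t) (h2 : i s = i u) (h3 : i r ≠ i s) :
    π.intersectionGraph.Adj (π.block r) (π.block s) :=
  intersectionGraph_adj.2 ⟨fun h => h3 (hi.block_eq_iff.1 h), Or.inl ⟨r, mem_block r, s, mem_block s,
    t, hi.mem_block_iff.2 h1.symm, u, hi.mem_block_iff.2 h2.symm, hrs, hst, htu⟩⟩

theorem ncSelection_colorSelection (hpair : π.IsPair) (hi : π.IsKernelOf i)
    (κ : π.intersectionGraph.Coloring Bool) : NCSelection i (colorSelection κ) where
  ne r := by
    cases h : κ (π.block r) <;> simp [colorSelection, h]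
  fst := hpair.ncWord_subword hi (fun r s h => by simp [colorSelection, hi.block_eq_iff.2 h])
    fun r s t u hrs hst htu h1 h2 h3 hr hs =>
      κ.valid (adj_block hi hrs hst htu h1 h2 h3) (by simp_all [colorSelection])
  snd := hpair.ncWord_subword hi (fun r s h => by simp [colorSelection, hi.block_eq_iff.2 h])
    fun r s t u hrs hst htu h1 h2 h3 hr hs =>
      κ.valid (adj_block hi hrs hst htu h1 h2 h3) (by simp_all [colorSelection])

/-- Neither leg may carry both blocks, and each block needs a leg; only the two opposite assignments
remain. -/
theorem NCSelection.of_crosses {f : Fin p → Bool × Bool} (h : NCSelection i f) (hpair : π.IsPair)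
    (hi : π.IsKernelOf i) {V W : {V : Finset (Fin p) // V ∈ π.parts}} (hne : V ≠ W)
    (hVW : Crosses V.1 W.1) {v w : Fin p} (hv : v ∈ V.1) (hw : w ∈ W.1) :
    (f v).1 ≠ (f w).1 ∧ (f v).2 = !(f v).1 ∧ (f w).2 = !(f w).1 := by
  obtain ⟨r, hr, s, hs, t, ht, u, hu, hrs, hst, htu⟩ := hVW
  have hVi : ∀ x ∈ V.1, i x = i v := fun x hx =>
    hi.block_eq_iff.1 ((block_eq_of_mem hx).trans (block_eq_of_mem hv).symm)
  have hWi : ∀ x ∈ W.1, i x = i w := fun x hx =>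
    hi.block_eq_iff.1 ((block_eq_of_mem hx).trans (block_eq_of_mem hw).symm)
  have hnei : i v ≠ i w := fun e =>
    hne ((block_eq_of_mem hv).symm.trans ((hi.block_eq_iff.2 e).trans (block_eq_of_mem hw)))
  have key : ∀ g : Fin p → Bool, NCWord (subword i g) → ¬ (g v = true ∧ g w = true) := by
    rintro g hg ⟨h1, h2⟩
    refine not_ncWord_of_crossing hrs hst htu ((hVi r hr).trans (hVi t ht).symm)
      ((hWi s hs).trans (hWi u hu).symm) (by rwa [hVi r hr, hWi s hs]) ?_ ?_ ?_ ?_ hg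
    · rwa [hpair.eq_of_ncWord hi hg (hVi r hr)]
    · rwa [hpair.eq_of_ncWord hi hg (hWi s hs)]
    · rwa [hpair.eq_of_ncWord hi hg (hVi t ht)]
    · rwa [hpair.eq_of_ncWord hi hg (hWi u hu)]
  have k1 := key _ h.fst
  have k2 := key _ h.snd
  have n1 := h.ne v
  have n2 := h.ne w
  revert k1 k2 n1 n2
  generalize f v = x
  generalize f w = y
  revert x y
  decide

/-- A neighbor excludes the value `(true, true)` on a block. For `p = 2` there is no neighbor, which
is why `2 < p` is needed. -/
theorem NCSelection.exists_coloring {f : Fin p → Bool × Bool} (h : NCSelection i f)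
    (hpair : π.IsPair) (hconn : π.IsConnected) (hp : 2 < p) (hi : π.IsKernelOf i) :
    ∃ κ : π.intersectionGraph.Coloring Bool, f = colorSelection κ := by
  have hadj : ∀ {V W : {V : Finset (Fin p) // V ∈ π.parts}}, π.intersectionGraph.Adj V W →
      ∀ v ∈ V.1, ∀ w ∈ W.1, (f v).1 ≠ (f w).1 ∧ (f v).2 = !(f v).1 := by
    intro V W hVW v hv w hw
    obtain ⟨hne, hc | hc⟩ := intersectionGraph_adj.1 hVW
    · have := h.of_crosses hpair hi hne hc hv hw
      exact ⟨this.1, this.2.1⟩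
    · have := h.of_crosses hpair hi hne.symm hc hw hv
      exact ⟨this.1.symm, this.2.2⟩
  choose rep hrep using fun V : {V : Finset (Fin p) // V ∈ π.parts} => π.nonempty_of_mem_parts V.2
  refine ⟨SimpleGraph.Coloring.mk (fun V => (f (rep V)).1) fun {V W} hVW =>
    (hadj hVW _ (hrep V) _ (hrep W)).1, ?_⟩
  funext r
  have h1 : (f (rep (π.block r))).1 = (f r).1 :=
    hpair.eq_of_ncWord hi h.fst (hi.mem_block_iff.1 (hrep _))
  obtain ⟨W, hW⟩ := hpair.exists_adj hconn hp (π.block r)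
  have h2 := (hadj hW r (mem_block r) _ (hrep W)).2
  change f r = ((f (rep (π.block r))).1, !(f (rep (π.block r))).1)
  rw [h1, ← h2]

/-- Both colorings flip along every edge, so agreement or disagreement at one block propagates
through the connected graph. -/
theorem colorSelection_eq_or (hconn : π.IsConnected) (κ κ' : π.intersectionGraph.Coloring Bool) :
    colorSelection κ' = colorSelection κ ∨
      colorSelection κ' = fun r => (colorSelection κ r).swap := by
  have key : ∀ V W, (κ' V = κ V ↔ κ' W = κ W) := by
    intro V W
    have := hconn.preconnected V W
    rw [SimpleGraph.reachable_iff_reflTransGen] at this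
    induction this with
    | refl => rfl
    | tail _ h ih =>
      refine ih.trans ?_
      have h1 := κ.valid h
      have h2 := κ'.valid h
      revert h1 h2
      generalize κ _ = a
      generalize κ _ = b
      generalize κ' _ = a'
      generalize κ' _ = b'
      revert a b a' b'
      decide
  by_cases h : ∃ V, κ' V = κ V
  · obtain ⟨V, hV⟩ := h
    left
    funext r
    simp [colorSelection, (key V (π.block r)).1 hV]
  · push Not at h
    right
    funext r
    have := Bool.eq_not.2 (h (π.block r))
    simp [colorSelection, this]

end PointPartition

/-! ### Expansion over tensor legs -/

section Expansion

variable {A : Type*} [Ring A] [Algebra ℂ A] {τ : A →ₗ[ℂ] ℂ}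

theorem tensorState_tmul (y z : A) : tensorState τ (y ⊗ₜ[ℂ] z) = τ y * τ z := by
  simp [tensorState]

theorem ncVariance_eq {φ : A →ₗ[ℂ] ℂ} (h1 : φ 1 = 1) (y : A) :
    ncVariance φ y = φ (y ^ 2) - φ y ^ 2 := by
  have : centered φ y ^ 2 = y ^ 2 - (2 * φ y) • y + (φ y ^ 2) • (1 : A) := by
    rw [centered, Algebra.algebraMap_eq_smul_one, sq, sub_mul, mul_sub, mul_sub]
    simp only [smul_mul_assoc, mul_smul_comm, one_mul, mul_one, smul_smul, sq]
    rw [two_mul, add_smul]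
    abel
  rw [ncVariance, this, map_add, map_sub, map_smul, map_smul, h1]
  simp only [smul_eq_mul]
  ring

theorem ncVariance_tensorState_tmul {lam σ : ℝ} (h1 : τ 1 = 1) {a : A} (hmean : τ a = lam)
    (hvar : ncVariance τ a = ((σ ^ 2 : ℝ) : ℂ)) :
    ncVariance (tensorState τ) (a ⊗ₜ[ℂ] a) = ((σ ^ 2 * (σ ^ 2 + 2 * lam ^ 2) : ℝ) : ℂ) := by
  have h1' : tensorState τ 1 = 1 := by
    rw [Algebra.TensorProduct.one_def, tensorState_tmul, h1, one_mul]
  rw [ncVariance_eq h1, hmean] at hvar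
  have h2 : τ (a ^ 2) = ((σ ^ 2 : ℝ) : ℂ) + lam ^ 2 := by rw [← hvar]; ring
  rw [ncVariance_eq h1', Algebra.TensorProduct.tmul_pow, tensorState_tmul, tensorState_tmul, hmean,
    h2]
  push_cast
  ring

/-- The coefficients of `(c + lam) ⊗ (c + lam) - lam ^ 2` with respect to `1 ⊗ 1`, `c ⊗ 1`,
`1 ⊗ c` and `c ⊗ c`. -/
def selectionWeight (lam : ℂ) : Bool × Bool → ℂ
  | (true, true) => 1
  | (true, false) => lam
  | (false, true) => lam
  | (false, false) => 0

theorem normalizedTensor_eq_sum (a : A) {y : A} {lam : ℂ} (hy : τ y = lam) :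
    normalizedTensor τ a y = ∑ t : Bool × Bool,
      ((tensorStdDev τ a : ℂ)⁻¹ * selectionWeight lam t) •
        ((bif t.1 then centered τ y else 1) ⊗ₜ[ℂ] (bif t.2 then centered τ y else 1)) := by
  have hyc : y = centered τ y + lam • (1 : A) := by
    rw [centered, hy, Algebra.algebraMap_eq_smul_one]
    abel
  rw [Fintype.sum_prod_type]
  simp only [Fintype.sum_bool, selectionWeight, cond_true, cond_false, normalizedTensor]
  rw [centered, tensorState_tmul, hy, Algebra.algebraMap_eq_smul_one,
    Algebra.TensorProduct.one_def]
  generalize centered τ y = c at hyc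
  subst hyc
  simp only [TensorProduct.add_tmul, TensorProduct.tmul_add, TensorProduct.smul_tmul',
    TensorProduct.tmul_smul, smul_smul, smul_sub, smul_add, mul_one, mul_zero, zero_smul, add_zero]
  abel

theorem prod_ofFn_tmul {p : ℕ} (y z : Fin p → A) :
    (List.ofFn fun r => y r ⊗ₜ[ℂ] z r).prod = (List.ofFn y).prod ⊗ₜ[ℂ] (List.ofFn z).prod := by
  simp only [List.ofFn_eq_map]
  induction List.finRange p with
  | nil => rfl
  | cons r l ih => simp [ih]

theorem prod_ofFn_cond {M : Type*} [Monoid M] {p : ℕ} (c : ℕ → M) (i : Fin p → ℕ) (g : Fin p → Bool) :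
    (List.ofFn fun r => bif g r then c (i r) else 1).prod
      = ((PointPartition.subword i g).map c).prod := by
  rw [List.ofFn_eq_map, PointPartition.subword]
  induction List.finRange p with
  | nil => rfl
  | cons r l ih => cases h : g r <;> simp [ih, h]

theorem tensorState_prod_normalizedTensor (a : A) {x : ℕ → A} {lam : ℂ} (hx : ∀ k, τ (x k) = lam)
    {p : ℕ} (i : Fin p → ℕ) :
    tensorState τ (List.ofFn fun r => normalizedTensor τ a (x (i r))).prod
      = ∑ f : Fin p → Bool × Bool, (∏ r, (tensorStdDev τ a : ℂ)⁻¹ * selectionWeight lam (f r)) *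
        (τ ((PointPartition.subword i fun r => (f r).1).map fun k => centered τ (x k)).prod *
          τ ((PointPartition.subword i fun r => (f r).2).map fun k => centered τ (x k)).prod) := by
  simp only [normalizedTensor_eq_sum a (hx _)]
  -- Viewing the ordered product as a multilinear map turns the product of sums into a sum over all
  -- choices `f`.
  rw [← MultilinearMap.mkPiAlgebraFin_apply (R := ℂ), MultilinearMap.map_sum, map_sum]
  refine Finset.sum_congr rfl fun f _ => ?_
  rw [MultilinearMap.map_smul_univ, MultilinearMap.mkPiAlgebraFin_apply, prod_ofFn_tmul,
    prod_ofFn_cond (fun k => centered τ (x k)), prod_ofFn_cond (fun k => centered τ (x k)), map_smul,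
    tensorState_tmul, smul_eq_mul]

end Expansion

/-! ### Evaluation of the surviving terms -/

namespace PointPartition

variable {p : ℕ} {π : PointPartition p} {i : Fin p → ℕ}

theorem NCSelection.swap {f : Fin p → Bool × Bool} (h : NCSelection i f) :
    NCSelection i fun r => (f r).swap where
  ne r := fun e => h.ne r (by simpa using congrArg Prod.swap e)
  fst := h.snd
  snd := h.fst

theorem length_subword_add_not (g : Fin p → Bool) :
    (subword i g).length + (subword i fun r => !g r).length = p := by
  simp only [subword, List.length_map]
  conv_rhs => rw [← List.length_finRange (n := p)]
  induction List.finRange p with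
  | nil => rfl
  | cons r l ih => cases h : g r <;> simp [h] <;> omega

end PointPartition

theorem proposition5p4 {A : Type*} [Ring A] [StarRing A] [Algebra ℂ A] [StarModule ℂ A]
    (τ : A →ₗ[ℂ] ℂ) (hτ : IsFaithfulTracialState τ)
    (a : A) (ha : IsSelfAdjoint a)
    (lam σ : ℝ) (hmean : τ a = (lam : ℂ)) (hvar : ncVariance τ a = ((σ ^ 2 : ℝ) : ℂ)) (hσ : σ ≠ 0)
    (x : ℕ → A) (hx : ∀ k, IsSelfAdjoint (x k)) (hlaw : ∀ k, SameLaw τ (x k) a)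
    (hfree : FreeVariables τ x)
    (q : ℝ) (hq : q = 2 * lam ^ 2 / (σ ^ 2 + 2 * lam ^ 2))
    (p : ℕ) (hp : 4 ≤ p) (hpeven : Even p)
    (π : PointPartition p) (hpair : π.IsPair) (hconn : π.IsConnected)
    (i : Fin p → ℕ) (hi : π.IsKernelOf i) :
    (¬ π.intersectionGraph.IsBipartite →
      tensorState τ (List.ofFn fun r => normalizedTensor τ a (x (i r))).prod = 0) ∧
    (π.intersectionGraph.IsBipartite →
      tensorState τ (List.ofFn fun r => normalizedTensor τ a (x (i r))).prod =
        ((2 * (q / 2) ^ (p / 2) : ℝ) : ℂ)) := by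
  have h1 := hτ.map_one
  have hmean' : ∀ k, τ (x k) = lam := fun k => by
    simpa [hmean] using hlaw k 1
  set c : ℕ → A := fun k => centered τ (x k) with hc
  have hS : ∀ k, c k ∈ Algebra.adjoin ℂ {x k} := fun k =>
    sub_mem (Algebra.self_mem_adjoin_singleton ℂ (x k)) (Subalgebra.algebraMap_mem _ _)
  have h0 : ∀ k, τ (c k) = 0 := fun k => by
    simp [hc, centered, Algebra.algebraMap_eq_smul_one, h1]
  have hs : ∀ k, τ (c k ^ 2) = (σ : ℂ) ^ 2 := fun k => by
    change ncVariance τ (x k) = _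
    rw [ncVariance_eq h1, hlaw k 2, hmean', ← hmean, ← ncVariance_eq h1, hvar]
    push_cast
    rfl
  rw [tensorState_prod_normalizedTensor a hmean' i]
  set δ : ℂ := (tensorStdDev τ a : ℂ) with hδ
  have hzero : ∀ f : Fin p → Bool × Bool, ¬ PointPartition.NCSelection i f →
      (∏ r, δ⁻¹ * selectionWeight lam (f r)) *
        (τ ((PointPartition.subword i fun r => (f r).1).map c).prod *
          τ ((PointPartition.subword i fun r => (f r).2).map c).prod) = 0 := by
    intro f hf
    by_cases hne : ∀ r, f r ≠ (false, false)
    · by_cases hf1 : NCWord (PointPartition.subword i fun r => (f r).1)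
      · rw [FreeSubalgebras.map_prod_of_not_ncWord h1 hfree hS h0 hs (PointPartition.subword i fun r => (f r).2)
          (hpair.count_subword_le hi) fun hf2 => hf ⟨hne, hf1, hf2⟩, mul_zero, mul_zero]
      · rw [FreeSubalgebras.map_prod_of_not_ncWord h1 hfree hS h0 hs (PointPartition.subword i fun r => (f r).1)
          (hpair.count_subword_le hi) hf1, zero_mul, mul_zero]
    · push Not at hne
      obtain ⟨r, hr⟩ := hne
      rw [Finset.prod_eq_zero (Finset.mem_univ r) (by simp [hr, selectionWeight]), zero_mul]
  constructor
  · intro hbip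
    refine Finset.sum_eq_zero fun f _ => hzero f fun hf => hbip ?_
    obtain ⟨κ, -⟩ := hf.exists_coloring hpair hconn (by omega) hi
    simpa using κ.colorable
  · intro hbip
    let κ : π.intersectionGraph.Coloring Bool := hbip.toColoring (by simp)
    -- With exactly one leg used at each point, every weight is `δ⁻¹ * lam` and the two word lengths
    -- add up to `p`.
    have hval : ∀ f : Fin p → Bool × Bool, PointPartition.NCSelection i f → (∀ r, (f r).2 = !(f r).1) →
        (∏ r, δ⁻¹ * selectionWeight lam (f r)) *
          (τ ((PointPartition.subword i fun r => (f r).1).map c).prod *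
            τ ((PointPartition.subword i fun r => (f r).2).map c).prod) = (δ⁻¹ * lam * σ) ^ p := by
      intro f hf hnot
      have hw : ∀ r, δ⁻¹ * selectionWeight lam (f r) = δ⁻¹ * lam := by
        intro r
        have := hnot r
        revert this
        generalize f r = y
        rcases y with ⟨_ | _, _ | _⟩ <;> simp [selectionWeight]
      rw [Finset.prod_congr rfl fun r _ => hw r,
        FreeSubalgebras.map_prod_of_ncWord h1 hfree hS h0 hs hf.fst,
        FreeSubalgebras.map_prod_of_ncWord h1 hfree hS h0 hs hf.snd, ← pow_add]
      simp only [hnot]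
      rw [PointPartition.length_subword_add_not, Finset.prod_const, Finset.card_univ, Fintype.card_fin, ← mul_pow]
    have hκ := PointPartition.ncSelection_colorSelection hpair hi κ
    have hne : PointPartition.colorSelection κ ≠ fun r => (PointPartition.colorSelection κ r).swap := by
      intro e
      have := congrArg Prod.fst (congrFun e ⟨0, by omega⟩)
      simp [PointPartition.colorSelection] at this
    rw [Fintype.sum_eq_add _ _ hne, hval _ hκ fun r => rfl,
      hval _ hκ.swap fun r => by simp [PointPartition.colorSelection]]
    · have hpos : 0 < σ ^ 2 := by positivity
      have hsum : σ ^ 2 + 2 * lam ^ 2 ≠ 0 := by positivity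
      have hδ2 : tensorStdDev τ a ^ 2 = σ ^ 2 * (σ ^ 2 + 2 * lam ^ 2) := by
        rw [tensorStdDev, ncVariance_tensorState_tmul h1 hmean hvar, Complex.ofReal_re]
        exact Real.sq_sqrt (by positivity)
      obtain ⟨m, rfl⟩ := hpeven.two_dvd
      -- Only the square of `δ` is rational in `lam` and `σ`; evenness of `p` lets the power be
      -- taken of this square.
      have hreal : ((tensorStdDev τ a)⁻¹ * lam * σ) ^ 2 = q / 2 := by
        rw [mul_pow, mul_pow, inv_pow, hδ2, hq]
        field_simp
      rw [← two_mul, Nat.mul_div_cancel_left m two_pos, ← hreal, ← pow_mul, hδ]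
      push_cast
      rfl
    · rintro f ⟨hf1, hf2⟩
      refine hzero f fun hf => ?_
      obtain ⟨κ', rfl⟩ := hf.exists_coloring hpair hconn (by omega) hi
      rcases PointPartition.colorSelection_eq_or hconn κ κ' with e | e
      · exact hf1 e
      · exact hf2 e
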